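/- Let $\mathbb H^{2,1}$ be the right $\mathbb H$-vector space $\mathbb H^3$ with the Hermitian form $\langle z,w\rangle=\bar w_3z_1+\bar w_2z_2+\bar w_1z_3$, let $\mathrm{Sp}(2,1)$ be its isometry group, and let $\partial\mathbf H^2_{\mathbb H}\subset\mathbb{HP}^2$ be the set of null lines. An element $A\in\mathrm{Sp}(2,1)$ is *loxodromic* if it fixes exactly two points of $\partial\mathbf H^2_{\mathbb H}$ and has no real right eigenvalue; a pair $(A,B)$ is *totally loxodromic* if $A$ and $B$ are loxodromic. A loxodromic $A$ has eigenvalue representatives $\lambda=re^{i\theta}$, $r^{-1}e^{i\theta}$, $\mu=e^{i\phi}$ with $0<r<1$, $\theta,\phi\in(0,\pi)$, whose eigen-points are the attracting fixed point $a_A\in\partial\mathbf H^2_{\mathbb H}$, the repelling fixed point $r_A\in\partial\mathbf H^2_{\mathbb H}$ and the polar point $x_A$, which is a positive line. *Real trace.* Writing $A=A_1+jA_2$ with $A_1,A_2\in M_3(\mathbb C)$ and $A_{\mathbb C}=\begin{pmatrix}A_1&-\overline{A_2}\\A_2&\overline{A_1}\end{pmatrix}$, the real trace $tr_{\mathbb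 R}(A)=(a,b,c)\in\mathbb R^3$ is defined by $\det(x-A_{\mathbb C})=x^6-ax^5+bx^4-cx^3+bx^2-ax+1$. *Configuration.* Let $\overline{\mathrm M}(2)$ be the set of $\mathrm{Sp}(2,1)$-congruence classes of ordered quadruples of points of $\partial\mathbf H^2_{\mathbb H}$, and $\mathrm M(2)\subset\overline{\mathrm M}(2)$ the configuration space of classes of quadruples of pairwise distinct points. The pair $(A,B)$ defines the class $m(A,B)=[(a_A,r_A,a_B,r_B)]$, which lies in $\mathrm M(2)$ if and only if $A$ and $B$ have no common fixed point on $\partial\mathbf H^2_{\mathbb H}$. *Projective points.* Let $\mathbb{CP}^1$ be the set of classes of nonzero quaternions under $q\sim qc$, $c\in\mathbb C\setminus\{0\}$. Fix, once and for all, an arbitrary lift $v_p\in\mathbb H^{2,1}$ of each $p\in\mathbb{HP}^2$, which identifies the line $p=v_p\mathbb H$ with $\mathbb H$, and an arbitrary reference quadruple in each class of $\overline{\mathrm M}(2)$. The projective points of a loxodromic $A$ are $p_1(A)=[q_1]$ and $p_2(A)=[q_2]$ in $\mathbb{CP}^1$, where $A(v_pq_1)=v_pq_1\lambda$ with $p=a_A$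 and $A(v_pq_2)=v_pq_2\mu$ with $p=x_A$; that is, they are the complex lines $\{x: Ax=x\lambda\}$ and $\{x: Ax=x\mu\}$ in the respective eigen-lines. For a pair, projective points are taken in normalized position: $(P_1,P_2,P_3,P_4)\in(\mathbb{CP}^1)^4$ are projective points of $(A,B)$ if for some $g\in\mathrm{Sp}(2,1)$ carrying $(a_A,r_A,a_B,r_B)$ to the reference quadruple of its class they equal $p_1(gAg^{-1}),p_2(gAg^{-1}),p_1(gBg^{-1}),p_2(gBg^{-1})$. **Theorem.** A totally loxodromic pair $(A,B)$ in $\mathrm{Sp}(2,1)$ is uniquely determined up to simultaneous conjugation in $\mathrm{Sp}(2,1)$ by the parameters $tr_{\mathbb R}(A)$, $tr_{\mathbb R}(B)$, the point $m(A,B)$ corresponding to $(a_A,r_A,a_B,r_B)$, and the four projective points $(p_1(A),p_2(A))$, $(p_1(B),p_2(B))$. Precisely: every totally loxodromic pair has such a system of parameters, and for totally loxodromic pairs $(A,B)$ and $(A',B')$ the following are equivalent: (i) there is $g\in\mathrm{Sp}(2,1)$ with $gAg^{-1}=A'$ and $gBg^{-1}=B'$; (ii) $(A,B)$ and $(A',B')$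 have a common system of parameters; (iii) $(A,B)$ and $(A',B')$ have the same systems of parameters. -/

import Mathlib

open scoped Quaternion Matrix LinearAlgebra.Projectivization

noncomputable section

namespace QuatHyp

/-! ### The group `Sp(2,1)` and the quaternionic projective plane -/

/-- `ℍ³`, a right vector space over the quaternions: the scalar `q` acts on `v` as
`MulOpposite.op q • v = (vᵢ q)ᵢ`. -/
abbrev V : Type := Fin 3 → ℍ[ℝ]

/-- The matrix of the Hermitian form of signature `(2,1)` (Siegel domain model). -/
def H₁ : Matrix (Fin 3) (Fin 3) ℍ[ℝ] := !![0, 0, 1; 0, 1, 0; 1, 0, 0]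

/-- The Hermitian form `⟨z, w⟩ = w* H₁ z`. -/
def herm (z w : V) : ℍ[ℝ] := star w ⬝ᵥ (H₁ *ᵥ z)

/-- `Sp(2,1)`: the invertible quaternionic matrices `A` with `A* H₁ A = H₁`. -/
def Sp21 : Subgroup (Matrix (Fin 3) (Fin 3) ℍ[ℝ])ˣ where
  carrier := {A | (A : Matrix (Fin 3) (Fin 3) ℍ[ℝ])ᴴ * H₁ * A = H₁}
  one_mem' := by simp
  mul_mem' := by
    intro A B hA hB
    simp only [Set.mem_ofPred_eq, Units.val_mul, Matrix.conjTranspose_mul] at *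
    calc _ = (B : Matrix (Fin 3) (Fin 3) ℍ[ℝ])ᴴ *
          ((A : Matrix (Fin 3) (Fin 3) ℍ[ℝ])ᴴ * H₁ * A) * B := by simp only [mul_assoc]
      _ = H₁ := by rw [hA, hB]
  inv_mem' := by
    intro A hA
    simp only [Set.mem_ofPred_eq] at *
    have h1 : (A : Matrix (Fin 3) (Fin 3) ℍ[ℝ]) * (A⁻¹ : (Matrix (Fin 3) (Fin 3) ℍ[ℝ])ˣ) = 1 := by
      simp
    have h2 : ((A⁻¹ : (Matrix (Fin 3) (Fin 3) ℍ[ℝ])ˣ) : Matrix (Fin 3) (Fin 3) ℍ[ℝ])ᴴ *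
        (A : Matrix (Fin 3) (Fin 3) ℍ[ℝ])ᴴ = 1 := by
      rw [← Matrix.conjTranspose_mul, h1, Matrix.conjTranspose_one]
    conv_lhs => rw [← hA]
    calc _ = (((A⁻¹ : (Matrix (Fin 3) (Fin 3) ℍ[ℝ])ˣ) : Matrix (Fin 3) (Fin 3) ℍ[ℝ])ᴴ *
        (A : Matrix (Fin 3) (Fin 3) ℍ[ℝ])ᴴ) * H₁ * ((A : Matrix (Fin 3) (Fin 3) ℍ[ℝ]) *
          (A⁻¹ : (Matrix (Fin 3) (Fin 3) ℍ[ℝ])ˣ)) := by simp only [mul_assoc]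
      _ = H₁ := by rw [h1, h2, one_mul, mul_one]

/-- The underlying matrix of an element of `Sp(2,1)`. -/
abbrev mat (A : Sp21) : Matrix (Fin 3) (Fin 3) ℍ[ℝ] :=
  ((A : (Matrix (Fin 3) (Fin 3) ℍ[ℝ])ˣ) : Matrix (Fin 3) (Fin 3) ℍ[ℝ])

/-- The quaternionic projective plane of right lines in `ℍ³`, with the action of `Sp(2,1)`
induced by `(A, v) ↦ A v` (matrix times column vector). -/
abbrev HP2 : Type := ℙ (ℍ[ℝ])ᵐᵒᵖ V

/-- The boundary of the quaternionic hyperbolic plane: the null lines. -/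
def boundary : Set HP2 :=
  {p | ∃ (v : V) (hv : v ≠ 0), Projectivization.mk (ℍ[ℝ])ᵐᵒᵖ v hv = p ∧ herm v v = 0}

/-- The points of `HP²` spanned by positive vectors. -/
def positivePoints : Set HP2 :=
  {p | ∃ (v : V) (hv : v ≠ 0), Projectivization.mk (ℍ[ℝ])ᵐᵒᵖ v hv = p ∧ 0 < (herm v v).re}

/-! ### Loxodromic elements and their fixed points -/

/-- `p` is an eigen-point of `A` with right eigenvalue `lam`: `A v = v lam` for some lift `v` of
`p`. -/
def IsEigenpoint (A : Sp21) (p : HP2) (lam : ℍ[ℝ]) : Prop :=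
  ∃ (v : V) (hv : v ≠ 0), Projectivization.mk (ℍ[ℝ])ᵐᵒᵖ v hv = p ∧
    mat A *ᵥ v = MulOpposite.op lam • v

/-- `A` fixes exactly two points of the boundary. -/
def IsHyperbolic (A : Sp21) : Prop := {p ∈ boundary | A • p = p}.ncard = 2

/-- A loxodromic element is a hyperbolic element without real eigenvalues. -/
def IsLoxodromic (A : Sp21) : Prop :=
  IsHyperbolic A ∧ ∀ (p : HP2) (lam : ℍ[ℝ]), IsEigenpoint A p lam → ∀ t : ℝ, lam ≠ (t : ℍ[ℝ])

/-- A pair is totally loxodromic if both members are loxodromic. -/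
def TotallyLoxodromic (A B : Sp21) : Prop := IsLoxodromic A ∧ IsLoxodromic B

/-- `p` is the attracting fixed point of `A` (eigenvalue class of modulus less than one). -/
def IsAttracting (A : Sp21) (p : HP2) : Prop :=
  p ∈ boundary ∧ ∃ lam : ℍ[ℝ], ‖lam‖ < 1 ∧ IsEigenpoint A p lam

/-- `p` is the repelling fixed point of `A` (eigenvalue class of modulus greater than one). -/
def IsRepelling (A : Sp21) (p : HP2) : Prop :=
  p ∈ boundary ∧ ∃ lam : ℍ[ℝ], 1 < ‖lam‖ ∧ IsEigenpoint A p lam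

/-- `p` is the polar point of `A` (positive, eigenvalue class of modulus one). -/
def IsPolar (A : Sp21) (p : HP2) : Prop :=
  p ∈ positivePoints ∧ ∃ lam : ℍ[ℝ], ‖lam‖ = 1 ∧ IsEigenpoint A p lam

/-! ### The real trace -/

/-- With `q = c₁ + j c₂` and `c₁, c₂` complex, this is `c₁`. -/
def complexPart₁ (q : ℍ[ℝ]) : ℂ := ⟨q.re, q.imI⟩

/-- With `q = c₁ + j c₂` and `c₁, c₂` complex, this is `c₂`. -/
def complexPart₂ (q : ℍ[ℝ]) : ℂ := ⟨q.imJ, -q.imK⟩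

/-- The complex representation of `A = A₁ + j A₂`, a complex `6 × 6` matrix with block rows
`(A₁, -conj A₂)` and `(A₂, conj A₁)`. -/
def toComplex (A : Matrix (Fin 3) (Fin 3) ℍ[ℝ]) : Matrix (Fin 3 ⊕ Fin 3) (Fin 3 ⊕ Fin 3) ℂ :=
  Matrix.fromBlocks (A.map complexPart₁) (-(A.map fun q => star (complexPart₂ q)))
    (A.map complexPart₂) (A.map fun q => star (complexPart₁ q))

/-- The real trace `(a, b, c)`: the characteristic polynomial of the complex representation is
`x⁶ - a x⁵ + b x⁴ - c x³ + b x² - a x + 1`. -/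
def realTrace (A : Sp21) : ℝ × ℝ × ℝ :=
  (-((toComplex (mat A)).charpoly.coeff 5).re, ((toComplex (mat A)).charpoly.coeff 4).re,
    -((toComplex (mat A)).charpoly.coeff 3).re)

/-! ### Configurations of boundary quadruples -/

/-- Ordered quadruples of boundary points (coincidences allowed). -/
abbrev Quadruple : Type := {p : Fin 4 → HP2 // ∀ i, p i ∈ boundary}

/-- `Sp(2,1)`-congruence of ordered quadruples. -/
instance congruence : Setoid Quadruple where
  r p q := ∃ g : Sp21, ∀ i, g • p.1 i = q.1 i
  iseqv :=
    { refl := fun _ => ⟨1, fun _ => one_smul _ _⟩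
      symm := by
        rintro p q ⟨g, hg⟩
        exact ⟨g⁻¹, fun i => by rw [← hg i, inv_smul_smul]⟩
      trans := by
        rintro p q r ⟨g, hg⟩ ⟨h, hh⟩
        exact ⟨h * g, fun i => by rw [mul_smul, hg i, hh i]⟩ }

/-- Congruence classes of ordered quadruples of boundary points. -/
abbrev Configuration : Type := Quotient congruence

/-- The configuration space `M(2)` of congruence classes of ordered quadruples of pairwise
distinct boundary points. -/
def M2 : Set Configuration := {m | ∃ q : Quadruple, Function.Injective q.1 ∧ ⟦q⟧ = m}

/-- `q` is the quadruple `(a_A, r_A, a_B, r_B)`. -/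
def IsFixedQuadruple (A B : Sp21) (q : Quadruple) : Prop :=
  IsAttracting A (q.1 0) ∧ IsRepelling A (q.1 1) ∧ IsAttracting B (q.1 2) ∧ IsRepelling B (q.1 3)

/-! ### Projective points -/

/-- Two nonzero quaternions are equivalent if they differ by a complex factor on the right. -/
instance complexLine : Setoid {q : ℍ[ℝ] // q ≠ 0} where
  r q q' := ∃ c : ℂ, c ≠ 0 ∧ q'.1 = q.1 * (c : ℍ[ℝ])
  iseqv :=
    { refl := fun q => ⟨1, one_ne_zero, by simp⟩
      symm := by
        rintro q q' ⟨c, hc, h⟩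
        refine ⟨c⁻¹, inv_ne_zero hc, ?_⟩
        rw [h, mul_assoc, ← Quaternion.coeComplex_mul, mul_inv_cancel₀ hc]
        simp
      trans := by
        rintro q q' q'' ⟨c, hc, h⟩ ⟨d, hd, h'⟩
        exact ⟨c * d, mul_ne_zero hc hd, by
          rw [h', h, mul_assoc, ← Quaternion.coeComplex_mul]⟩ }

/-- The complex projective line, as the set of complex lines in `ℍ = ℂ²`. -/
abbrev CP1 : Type := Quotient complexLine

/-- The choices needed to give coordinates to projective points: a representative quadruple for
each congruence class, and a lift of each point of `HP²`; the lift `v` of `p` identifies the line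
`p = vℍ` with `ℍ`. -/
structure Reference where
  quad : Configuration → Quadruple
  quad_class : ∀ m, ⟦quad m⟧ = m
  lift : HP2 → V
  lift_ne_zero : ∀ p, lift p ≠ 0
  mk_lift : ∀ p, Projectivization.mk (ℍ[ℝ])ᵐᵒᵖ (lift p) (lift_ne_zero p) = p

/-- `P` is the projective point of `A` at the eigen-point `p = vℍ` for the complex eigenvalue
representative `lam`: the eigenset `{x ∈ vℍ | A x = x lam}` is the complex line `v q ℂ`, where
`P` is the class of `q`. -/
def IsProjectivePoint (R : Reference) (A : Sp21) (p : HP2) (lam : ℂ) (P : CP1) : Prop :=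
  ∃ q : {q : ℍ[ℝ] // q ≠ 0}, P = ⟦q⟧ ∧
    mat A *ᵥ (MulOpposite.op q.1 • R.lift p) =
      MulOpposite.op (lam : ℍ[ℝ]) • (MulOpposite.op q.1 • R.lift p)

/-- `P` is the first projective point `p₁(A)`, that of the eigenvalue representative `r e^{iθ}`
with `r < 1` and `θ ∈ [0, π]`, at the attracting fixed point. -/
def IsFirstProjectivePoint (R : Reference) (A : Sp21) (P : CP1) : Prop :=
  ∃ (p : HP2) (lam : ℂ), IsAttracting A p ∧ ‖lam‖ < 1 ∧ 0 ≤ lam.im ∧ IsProjectivePoint R A p lam P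

/-- `P` is the second projective point `p₂(A)`, that of the eigenvalue representative `e^{iφ}`
with `φ ∈ [0, π]`, at the polar point. -/
def IsSecondProjectivePoint (R : Reference) (A : Sp21) (P : CP1) : Prop :=
  ∃ (p : HP2) (mu : ℂ), IsPolar A p ∧ ‖mu‖ = 1 ∧ 0 ≤ mu.im ∧ IsProjectivePoint R A p mu P

/-! ### The parameters of a pair -/

/-- Values for the parameters: two real traces, a configuration, four points of `CP¹`. -/
structure Parameters where
  trA : ℝ × ℝ × ℝ
  trB : ℝ × ℝ × ℝ
  config : Configuration
  p₁A : CP1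
  p₂A : CP1
  p₁B : CP1
  p₂B : CP1

/-- The parameters of `(A, B)`. The traces and the configuration are functions of the pair. The
projective points are read off after moving the pair by some `g`
so that its fixed points form the reference quadruple of their class. -/
def HasParameters (R : Reference) (A B : Sp21) (w : Parameters) : Prop :=
  realTrace A = w.trA ∧ realTrace B = w.trB ∧
  (∃ q : Quadruple, IsFixedQuadruple A B q ∧ ⟦q⟧ = w.config) ∧
  ∃ g : Sp21, IsFixedQuadruple (g * A * g⁻¹) (g * B * g⁻¹) (R.quad w.config) ∧
    IsFirstProjectivePoint R (g * A * g⁻¹) w.p₁A ∧ IsSecondProjectivePoint R (g * A * g⁻¹) w.p₂A ∧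
    IsFirstProjectivePoint R (g * B * g⁻¹) w.p₁B ∧ IsSecondProjectivePoint R (g * B * g⁻¹) w.p₂B

/-- Simultaneous conjugacy of pairs in `Sp(2,1)`. -/
def ConjugatePairs (A B A' B' : Sp21) : Prop :=
  ∃ g : Sp21, g * A * g⁻¹ = A' ∧ g * B * g⁻¹ = B'

end QuatHyp

end

open QuatHyp

open scoped Quaternion Matrix LinearAlgebra.Projectivization
open QuatHyp

noncomputable section

namespace QuatHyp

open MulOpposite
open scoped RightActions

/-! ### The Hermitian form -/

/-! A loxodromic element is diagonal in a frame `v`, `x`, `w`: null lifts of its attracting and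
repelling points with `herm v w = 1`, and a unit vector spanning their orthogonal complement. If the
eigenvalues on `v` and `x` are the complex numbers `l` and `m`, invariance of the form forces `(star
l)⁻¹` on `w`, so frame, `l` and `m` determine the element (`EigenFrame.eq`).

The parameters recover these data. The characteristic polynomial is self-reciprocal, hence given by
the real trace; moduli separate its roots, and the closed upper half plane picks one of each
conjugate pair (`EigenFrame.eigenvalues_eq`). The fixed points give the lines of `v` and `w`, hence
that of `x`. A projective point fixes a lift up to a complex factor, which commutes with the complex
eigenvalue and is harmless. This is `eq_of_projectivePoints`.

For pairs, the normalizing `g` is defined only up to the stabilizer of the reference quadruple, so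
parameters form a relation. Two pairs sharing one value become equal after normalization, hence are
conjugate; conversely, conjugation only changes the normalizing element. Existence rests on
`IsLoxodromic.exists_attracting_repelling`. -/

theorem herm_apply (z w : V) :
    herm z w = star (w 2) * z 0 + star (w 1) * z 1 + star (w 0) * z 2 := by
  simp [herm, H₁, Matrix.mulVec, dotProduct, Fin.sum_univ_three]
  abel

theorem herm_smul_left (z w : V) (q : ℍ[ℝ]) : herm (z <• q) w = herm z w * q := by
  simp [herm_apply, add_mul, mul_assoc]

theorem herm_smul_right (z w : V) (q : ℍ[ℝ]) : herm z (w <• q) = star q * herm z w := by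
  simp [herm_apply, mul_add, mul_assoc]

theorem herm_add_left (z z' w : V) : herm (z + z') w = herm z w + herm z' w := by
  simp [herm_apply, mul_add]; abel

theorem herm_add_right (z w w' : V) : herm z (w + w') = herm z w + herm z w' := by
  simp [herm_apply, add_mul]; abel

theorem star_herm (z w : V) : star (herm z w) = herm w z := by
  simp [herm_apply]; abel

theorem herm_self_eq_re (z : V) : herm z z = ((herm z z).re : ℍ[ℝ]) :=
  Quaternion.star_eq_self.1 (star_herm z z)

theorem herm_comm_eq_zero {z w : V} (h : herm z w = 0) : herm w z = 0 := by
  rw [← star_herm, h, star_zero]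

theorem herm_mulVec (A : Sp21) (z w : V) : herm (mat A *ᵥ z) (mat A *ᵥ w) = herm z w := by
  have hA : (mat A)ᴴ * H₁ * mat A = H₁ := A.2
  rw [herm, herm, Matrix.star_mulVec, ← Matrix.dotProduct_mulVec, Matrix.mulVec_mulVec,
    Matrix.mulVec_mulVec, hA]

theorem mulVec_ne_zero (A : Sp21) {v : V} (hv : v ≠ 0) : mat A *ᵥ v ≠ 0 :=
  (smul_ne_zero_iff_ne A).2 hv

theorem mat_mul (A B : Sp21) : mat (A * B) = mat A * mat B := rfl

theorem mat_mul_inv (A : Sp21) : mat A * mat A⁻¹ = 1 := by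
  rw [← mat_mul, mul_inv_cancel]; rfl

theorem mat_inv_mul (A : Sp21) : mat A⁻¹ * mat A = 1 := by
  rw [← mat_mul, inv_mul_cancel]; rfl

theorem mat_injective : Function.Injective mat :=
  fun _ _ h => Subtype.ext (Units.ext h)

theorem smul_right_ne_zero {v : V} (hv : v ≠ 0) {q : ℍ[ℝ]} (hq : q ≠ 0) : v <• q ≠ 0 :=
  smul_ne_zero (by simpa using hq) hv

theorem smul_right_smul_right (v : V) (p q : ℍ[ℝ]) : (v <• p) <• q = v <• (p * q) := by
  ext1 i; simp [mul_assoc]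

theorem eq_of_smul_right_eq {v : V} (hv : v ≠ 0) {p q : ℍ[ℝ]} (h : v <• p = v <• q) :
    p = q := by
  by_contra hne
  apply smul_right_ne_zero hv (sub_ne_zero.2 hne)
  have h' : v <• p - v <• q = 0 := sub_eq_zero.2 h
  rw [← h', op_sub, sub_smul]

/-- A vector orthogonal to a null vector is positive or proportional to it. -/
theorem pos_or_exists_of_orthogonal_null {v x : V} (hv : v ≠ 0) (hvv : herm v v = 0)
    (hxv : herm x v = 0) : 0 < (herm x x).re ∨ ∃ q : ℍ[ℝ], x = v <• q := by
  -- With `u 2 = 1`, orthogonality solves for `x 0`, and the form on `x` becomes the square norm of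
  -- `x 1 - u 1 * x 2`. It vanishes only for `x = u <• x 2`.
  have key : ∀ u : V, u 2 = 1 → herm u u = 0 → herm x u = 0 →
      0 < (herm x x).re ∨ ∃ q : ℍ[ℝ], x = u <• q := by
    intro u h2 huu hxu
    rw [herm_apply, h2] at huu hxu
    simp only [star_one, one_mul, mul_one] at huu hxu
    have hu0 : star (u 0) = -u 0 - star (u 1) * u 1 := by
      rw [eq_sub_iff_add_eq, eq_neg_iff_add_eq_zero, ← huu]
      abel
    have hx0 : x 0 = -star (u 1) * x 1 - star (u 0) * x 2 := by
      have : x 0 = (x 0 + star (u 1) * x 1 + star (u 0) * x 2)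
        - star (u 1) * x 1 - star (u 0) * x 2 := by abel
      rw [this, hxu]; noncomm_ring
    have hs : herm x x = star (x 1 - u 1 * x 2) * (x 1 - u 1 * x 2) := by
      rw [herm_apply, hx0]
      simp only [star_sub, star_mul, star_neg, star_star]
      rw [hu0]
      noncomm_ring
    rw [hs, Quaternion.star_mul_self, Quaternion.re_coe]
    by_cases hz : x 1 - u 1 * x 2 = 0
    · right
      have h1 : x 1 = u 1 * x 2 := sub_eq_zero.1 hz
      refine ⟨x 2, ?_⟩
      ext1 i
      fin_cases i
      · simp only [Fin.zero_eta, Pi.smul_apply, op_smul_eq_mul]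
        rw [hx0, h1, hu0]; noncomm_ring
      · simpa using h1
      · simp [h2]
    · exact Or.inl (lt_of_le_of_ne Quaternion.normSq_nonneg
        (Ne.symm (mt Quaternion.normSq_eq_zero.1 hz)))
  by_cases h2 : v 2 = 0
  -- The null line at infinity: `v` is a multiple of the first basis vector.
  · rw [herm_apply, h2] at hvv
    have h1 : v 1 = 0 := by
      have : Quaternion.normSq (v 1) = 0 := by
        have := congrArg QuaternionAlgebra.re hvv
        simpa [Quaternion.star_mul_self] using this
      exact Quaternion.normSq_eq_zero.1 this
    have h0 : v 0 ≠ 0 := by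
      intro h0
      apply hv
      ext1 i
      fin_cases i <;> simp [h0, h1, h2]
    have hx2 : x 2 = 0 := by
      rw [herm_apply, h2, h1] at hxv
      simpa [h0] using hxv
    by_cases hx1 : x 1 = 0
    · right
      refine ⟨(v 0)⁻¹ * x 0, ?_⟩
      ext1 i
      fin_cases i <;> simp [h1, h2, hx1, hx2, h0]
    · left
      rw [herm_apply, hx2]
      simp only [star_zero, zero_mul, zero_add, mul_zero, add_zero, Quaternion.star_mul_self,
        Quaternion.re_coe]
      exact lt_of_le_of_ne Quaternion.normSq_nonneg
        (Ne.symm (mt Quaternion.normSq_eq_zero.1 hx1))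
  · rcases key (v <• (v 2)⁻¹) (by simp [h2]) (by rw [herm_smul_left, herm_smul_right, hvv]; simp)
      (by rw [herm_smul_right, hxv, mul_zero]) with h | ⟨q, hq⟩
    · exact Or.inl h
    · exact Or.inr ⟨_, by rw [hq, smul_right_smul_right]⟩

/-- In signature `(2,1)` isotropic subspaces have dimension at most one. Hence lifts of distinct
boundary points pair nontrivially. -/
theorem exists_smul_of_null_orthogonal_null {v w : V} (hv : v ≠ 0) (hvv : herm v v = 0)
    (hww : herm w w = 0) (hwv : herm w v = 0) : ∃ q : ℍ[ℝ], w = v <• q := by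
  rcases pos_or_exists_of_orthogonal_null hv hvv hwv with h | h
  · rw [hww] at h; simp at h
  · exact h

/-- The orthogonal complement of two vectors contains a nonzero vector. -/
theorem exists_orthogonal (v w : V) : ∃ x : V, x ≠ 0 ∧ herm x v = 0 ∧ herm x w = 0 := by
  let f : V →ₗ[(ℍ[ℝ])ᵐᵒᵖ] (Fin 2 → ℍ[ℝ]) :=
    { toFun := fun x => ![herm x v, herm x w]
      map_add' := fun x y => by ext1 i; fin_cases i <;> simp [herm_add_left]
      map_smul' := fun q x => by
        obtain ⟨q, rfl⟩ := op_surjective q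
        ext1 i; fin_cases i <;> simp [herm_smul_left] }
  have hrank : Module.finrank (ℍ[ℝ])ᵐᵒᵖ ℍ[ℝ] = 1 :=
    finrank_eq_one 1 one_ne_zero fun q => ⟨op q, by simp⟩
  have : Module.Finite (ℍ[ℝ])ᵐᵒᵖ ℍ[ℝ] := Module.finite_of_finrank_eq_succ hrank
  -- Two linear conditions on a space of dimension three.
  have hker : LinearMap.ker f ≠ ⊥ := LinearMap.ker_ne_bot_of_finrank_lt (by
    simp [Module.finrank_pi_fintype, hrank])
  obtain ⟨x, hx, hx0⟩ := (Submodule.ne_bot_iff _).1 hker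
  have hfx : ![herm x v, herm x w] = 0 := hx
  exact ⟨x, hx0, congrFun hfx 0, congrFun hfx 1⟩

/-- A basis with Gram matrix `H₁` gives an element of `Sp(2,1)`. -/
theorem exists_frame {v x w : V} (hvv : herm v v = 0) (hww : herm w w = 0) (hvw : herm v w = 1)
    (hxv : herm x v = 0) (hxw : herm x w = 0) (hxx : herm x x = 1) :
    ∃ C : Sp21, ∀ y : V, mat C *ᵥ y = v <• y 0 + x <• y 1 + w <• y 2 := by
  let M : Matrix (Fin 3) (Fin 3) ℍ[ℝ] := (Matrix.of ![v, x, w])ᵀ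
  have hM : Mᴴ * H₁ * M = H₁ := by
    have hent : ∀ i j, (Mᴴ * H₁ * M) i j = herm (![v, x, w] j) (![v, x, w] i) := by
      intro i j
      rw [mul_assoc]
      rfl
    have hwv : herm w v = 1 := by rw [← star_herm, hvw, star_one]
    ext1 i j
    rw [hent]
    fin_cases i <;> fin_cases j <;>
      simp [H₁, hvv, hww, hvw, hwv, hxv, hxw, hxx, herm_comm_eq_zero hxv, herm_comm_eq_zero hxw]
  have hH : H₁ * H₁ = 1 := by
    ext1 i j
    fin_cases i <;> fin_cases j <;> simp [H₁, Matrix.mul_apply, Fin.sum_univ_three]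
  -- The Gram identity yields a left inverse; for square matrices over `ℍ` it is two-sided.
  have hl : (H₁ * Mᴴ * H₁) * M = 1 := by
    rw [mul_assoc, mul_assoc, ← mul_assoc Mᴴ, hM, hH]
  refine ⟨⟨⟨M, H₁ * Mᴴ * H₁, mul_eq_one_comm.1 hl, hl⟩, hM⟩, fun y => ?_⟩
  ext1 i
  simp [mat, Matrix.mulVec, dotProduct, Fin.sum_univ_three, M]

/-! ### Eigenvectors -/

theorem mk_eq_mk_iff_smul_right {v w : V} (hv : v ≠ 0) (hw : w ≠ 0) :
    Projectivization.mk (ℍ[ℝ])ᵐᵒᵖ v hv = Projectivization.mk (ℍ[ℝ])ᵐᵒᵖ w hw ↔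
      ∃ q : ℍ[ℝ], v = w <• q := by
  rw [Projectivization.mk_eq_mk_iff']
  exact ⟨fun ⟨a, ha⟩ => ⟨a.unop, by simp [ha]⟩, fun ⟨q, hq⟩ => ⟨op q, hq.symm⟩⟩

theorem mulVec_smul_right (M : Matrix (Fin 3) (Fin 3) ℍ[ℝ]) (v : V) (q : ℍ[ℝ]) :
    M *ᵥ (v <• q) = (M *ᵥ v) <• q :=
  Matrix.mulVec_smul M (op q) v

/-- Replacing an eigenvector by a proportional one conjugates the eigenvalue. -/
theorem mulVec_smul_right_of_eigen {M : Matrix (Fin 3) (Fin 3) ℍ[ℝ]} {v : V} {lam q c : ℍ[ℝ]}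
    (h : M *ᵥ v = v <• lam) (hq : lam * q = q * c) : M *ᵥ (v <• q) = (v <• q) <• c := by
  rw [mulVec_smul_right, h, smul_right_smul_right, smul_right_smul_right, hq]

theorem mul_coeComplex_eq_of_components {lam q : ℍ[ℝ]} {c : ℂ}
    (h₁ : lam.re * q.re - lam.imI * q.imI - lam.imJ * q.imJ - lam.imK * q.imK =
      q.re * c.re - q.imI * c.im)
    (h₂ : lam.re * q.imI + lam.imI * q.re + lam.imJ * q.imK - lam.imK * q.imJ =
      q.re * c.im + q.imI * c.re)
    (h₃ : lam.re * q.imJ - lam.imI * q.imK + lam.imJ * q.re + lam.imK * q.imI =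
      q.imJ * c.re + q.imK * c.im)
    (h₄ : lam.re * q.imK + lam.imI * q.imJ - lam.imJ * q.imI + lam.imK * q.re =
      q.imK * c.re - q.imJ * c.im) : lam * q = q * (c : ℍ[ℝ]) := by
  apply Quaternion.ext <;> simp <;> linarith

/-- Every quaternion is similar to a complex number in the closed upper half plane. -/
theorem exists_complex_similar (lam : ℍ[ℝ]) :
    ∃ (q : ℍ[ℝ]) (c : ℂ), q ≠ 0 ∧ 0 ≤ c.im ∧ lam * q = q * (c : ℍ[ℝ]) := by
  -- Let `u` be the imaginary part of `lam`, of norm `s`. Since `u² = -s²`, the quaternion `q = u +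
  -- s i` satisfies `u q = q (s i)`. It vanishes only when `u = -s i`, and then `q = j` works.
  set s := √(lam.imI ^ 2 + lam.imJ ^ 2 + lam.imK ^ 2) with hs
  have hs2 : s ^ 2 = lam.imI ^ 2 + lam.imJ ^ 2 + lam.imK ^ 2 := Real.sq_sqrt (by positivity)
  by_cases h : (⟨0, lam.imI + s, lam.imJ, lam.imK⟩ : ℍ[ℝ]) = 0
  · have hI : lam.imI + s = 0 := congrArg QuaternionAlgebra.imI h
    have hJ : lam.imJ = 0 := congrArg QuaternionAlgebra.imJ h
    have hK : lam.imK = 0 := congrArg QuaternionAlgebra.imK h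
    refine ⟨⟨0, 0, 1, 0⟩, ⟨lam.re, s⟩, ?_, Real.sqrt_nonneg _, ?_⟩
    · intro h'
      simpa using congrArg QuaternionAlgebra.imJ h'
    · apply mul_coeComplex_eq_of_components <;> simp [hJ, hK] <;> linarith
  · refine ⟨_, ⟨lam.re, s⟩, h, Real.sqrt_nonneg _, ?_⟩
    apply mul_coeComplex_eq_of_components <;> simp <;> linarith

theorem norm_eq_of_similar {lam q c : ℍ[ℝ]} (hq : q ≠ 0) (h : lam * q = q * c) : ‖c‖ = ‖lam‖ := by
  have := congrArg norm h
  rw [norm_mul, norm_mul, mul_comm] at this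
  exact (mul_left_cancel₀ (norm_ne_zero_iff.2 hq) this).symm

/-- Changing the lift conjugates the eigenvalue, so its norm depends only on the eigen-point. -/
theorem IsEigenpoint.exists_of_mk {A : Sp21} {p : HP2} {lam : ℍ[ℝ]} (h : IsEigenpoint A p lam)
    {v : V} (hv : v ≠ 0) (hp : Projectivization.mk (ℍ[ℝ])ᵐᵒᵖ v hv = p) :
    ∃ l : ℍ[ℝ], ‖l‖ = ‖lam‖ ∧ mat A *ᵥ v = v <• l := by
  obtain ⟨u, hu, rfl, hAu⟩ := h
  obtain ⟨q, rfl⟩ := (mk_eq_mk_iff_smul_right hv hu).1 hp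
  have hq : q ≠ 0 := by rintro rfl; simp at hv
  have e : lam * q = q * (q⁻¹ * lam * q) := by simp [mul_assoc, hq]
  exact ⟨q⁻¹ * lam * q, norm_eq_of_similar hq e, mulVec_smul_right_of_eigen hAu e⟩

theorem herm_self_of_mem_boundary {p : HP2} (h : p ∈ boundary) {v : V} (hv : v ≠ 0)
    (hp : Projectivization.mk (ℍ[ℝ])ᵐᵒᵖ v hv = p) : herm v v = 0 := by
  obtain ⟨u, hu, rfl, huu⟩ := h
  obtain ⟨q, rfl⟩ := (mk_eq_mk_iff_smul_right hv hu).1 hp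
  simp [herm_smul_left, herm_smul_right, huu]

theorem herm_self_pos_of_mem_positivePoints {p : HP2} (h : p ∈ positivePoints) {v : V}
    (hv : v ≠ 0) (hp : Projectivization.mk (ℍ[ℝ])ᵐᵒᵖ v hv = p) : 0 < (herm v v).re := by
  obtain ⟨u, hu, rfl, huu⟩ := h
  obtain ⟨q, rfl⟩ := (mk_eq_mk_iff_smul_right hv hu).1 hp
  have hq : q ≠ 0 := by rintro rfl; simp at hv
  have : herm (u <• q) (u <• q) = (((herm u u).re * Quaternion.normSq q : ℝ) : ℍ[ℝ]) := by
    rw [herm_smul_left, herm_smul_right, herm_self_eq_re u, ← Quaternion.coe_commutes, mul_assoc,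
      Quaternion.star_mul_self]
    simp
  rw [this, Quaternion.re_coe]
  exact mul_pos huu (lt_of_le_of_ne Quaternion.normSq_nonneg
    (Ne.symm (mt Quaternion.normSq_eq_zero.1 hq)))

/-- Two eigenvectors are orthogonal unless their eigenvalues have inverse norms. -/
theorem herm_eigen_eq_zero {A : Sp21} {v w : V} {l k : ℍ[ℝ]} (hv : mat A *ᵥ v = v <• l)
    (hw : mat A *ᵥ w = w <• k) (h : ‖l‖ * ‖k‖ ≠ 1) : herm v w = 0 := by
  have e := herm_mulVec A v w
  rw [hv, hw, herm_smul_left, herm_smul_right] at e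
  have e' := congrArg norm e
  rw [norm_mul, norm_mul, norm_star] at e'
  by_contra hne
  apply h
  apply mul_right_cancel₀ (norm_ne_zero_iff.2 hne)
  rw [one_mul]
  linarith

theorem smul_mk_eq_self_iff {A : Sp21} {v : V} (hv : v ≠ 0) :
    A • Projectivization.mk (ℍ[ℝ])ᵐᵒᵖ v hv = Projectivization.mk (ℍ[ℝ])ᵐᵒᵖ v hv ↔
      ∃ l : ℍ[ℝ], mat A *ᵥ v = v <• l := by
  exact mk_eq_mk_iff_smul_right (mulVec_ne_zero A hv) hv

theorem IsEigenpoint.smul_eq {A : Sp21} {p : HP2} {lam : ℍ[ℝ]} (h : IsEigenpoint A p lam) :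
    A • p = p := by
  obtain ⟨u, hu, rfl, hAu⟩ := h
  exact (smul_mk_eq_self_iff hu).2 ⟨lam, hAu⟩

/-! ### Hyperbolic pairs of null vectors and their orthogonal complement -/

theorem exists_normalized_of_herm_ne_zero {v w : V} (h : herm v w ≠ 0) :
    ∃ q : ℍ[ℝ], q ≠ 0 ∧ herm v (w <• q) = 1 := by
  refine ⟨star (herm v w)⁻¹, by simpa using h, ?_⟩
  rw [herm_smul_right, star_star, inv_mul_cancel₀ h]

theorem herm_ne_zero_of_mk_ne {v w : V} (hv : v ≠ 0) (hw : w ≠ 0)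
    (hne : Projectivization.mk (ℍ[ℝ])ᵐᵒᵖ v hv ≠ Projectivization.mk (ℍ[ℝ])ᵐᵒᵖ w hw)
    (hvv : herm v v = 0) (hww : herm w w = 0) : herm v w ≠ 0 := fun h =>
  hne ((mk_eq_mk_iff_smul_right hv hw).2 (exists_smul_of_null_orthogonal_null hw hww hvv h))

theorem ne_zero_of_herm_eq_one {v w : V} (h : herm v w = 1) : v ≠ 0 := by
  rintro rfl
  simp [herm_apply] at h

/-- The only other option is `x = v <• q`, and pairing with `w` then gives `q = 0`. -/
theorem herm_self_pos_of_orthogonal {v x w : V} (hvv : herm v v = 0) (hvw : herm v w = 1)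
    (hx : x ≠ 0) (hxv : herm x v = 0) (hxw : herm x w = 0) : 0 < (herm x x).re := by
  rcases pos_or_exists_of_orthogonal_null (ne_zero_of_herm_eq_one hvw) hvv hxv with h | ⟨q, rfl⟩
  · exact h
  · rw [herm_smul_left, hvw, one_mul] at hxw
    simp [hxw] at hx

theorem exists_unit_of_pos {x : V} (h : 0 < (herm x x).re) :
    ∃ t : ℝ, t ≠ 0 ∧ herm (x <• (t : ℍ[ℝ])) (x <• (t : ℍ[ℝ])) = 1 := by
  have hs : √(herm x x).re ≠ 0 := (Real.sqrt_pos.2 h).ne'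
  refine ⟨(√(herm x x).re)⁻¹, inv_ne_zero hs, ?_⟩
  rw [herm_smul_left, herm_smul_right, herm_self_eq_re x, Quaternion.star_coe,
    ← Quaternion.coe_mul, ← Quaternion.coe_mul, Quaternion.re_coe, ← Quaternion.coe_one]
  congr 1
  nth_rw 2 [← Real.sq_sqrt h.le]
  field_simp

/-- The orthogonal complement of a hyperbolic pair is a line. -/
theorem exists_smul_of_orthogonal {v x w y : V} (hvv : herm v v = 0) (hww : herm w w = 0)
    (hvw : herm v w = 1) (hx : x ≠ 0) (hxv : herm x v = 0) (hxw : herm x w = 0)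
    (hyv : herm y v = 0) (hyw : herm y w = 0) : ∃ q : ℍ[ℝ], y = x <• q := by
  obtain ⟨t, -, ht⟩ := exists_unit_of_pos (herm_self_pos_of_orthogonal hvv hvw hx hxv hxw)
  have hxv' : herm (x <• (t : ℍ[ℝ])) v = 0 := by rw [herm_smul_left, hxv, zero_mul]
  have hxw' : herm (x <• (t : ℍ[ℝ])) w = 0 := by rw [herm_smul_left, hxw, zero_mul]
  obtain ⟨C, hC⟩ := exists_frame hvv hww hvw hxv' hxw' ht
  have hwv : herm w v = 1 := by rw [← star_herm, hvw, star_one]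
  have hy := hC (mat C⁻¹ *ᵥ y)
  rw [Matrix.mulVec_mulVec, mat_mul_inv, Matrix.one_mulVec] at hy
  -- These are the coordinates of `y` in the frame; pairing with `v` reads off `z 2`, pairing with
  -- `w` reads off `z 0`.
  set z := mat C⁻¹ *ᵥ y
  have h2 : z 2 = 0 := by
    rw [hy] at hyv
    simpa only [herm_add_left, herm_smul_left, hvv, hxv, hwv, zero_mul, zero_add, one_mul]
      using hyv
  have h0 : z 0 = 0 := by
    rw [hy] at hyw
    simpa only [herm_add_left, herm_smul_left, hww, hxw, hvw, zero_mul, add_zero, one_mul]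
      using hyw
  refine ⟨t * z 1, ?_⟩
  rw [← smul_right_smul_right]
  rw [h0, h2] at hy
  simpa only [op_zero, zero_smul, zero_add, add_zero] using hy

/-- Invariance of the form gives `star k * l = 1`. Thus the repelling eigenvalue contributes no
parameter of its own. -/
theorem eigenvalue_eq_of_herm_eq_one {A : Sp21} {v w : V} {l k : ℍ[ℝ]}
    (hv : mat A *ᵥ v = v <• l) (hw : mat A *ᵥ w = w <• k) (hvw : herm v w = 1) :
    k = (star l)⁻¹ := by
  have e := herm_mulVec A v w
  rw [hv, hw, herm_smul_left, herm_smul_right, hvw, mul_one] at e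
  have e' := congrArg star e
  rw [star_mul, star_star, star_one] at e'
  exact eq_inv_of_mul_eq_one_right e'

theorem norm_mul_norm_of_herm_ne_zero {A : Sp21} {v w : V} {l k : ℍ[ℝ]}
    (hv : mat A *ᵥ v = v <• l) (hw : mat A *ᵥ w = w <• k) (hvw : herm v w ≠ 0) :
    ‖l‖ * ‖k‖ = 1 := by
  by_contra h
  exact hvw (herm_eigen_eq_zero hv hw h)

theorem eigenvalue_ne_zero {A : Sp21} {v : V} {l : ℍ[ℝ]} (h0 : v ≠ 0)
    (hv : mat A *ᵥ v = v <• l) : l ≠ 0 := by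
  rintro rfl
  apply mulVec_ne_zero A h0
  rw [hv, op_zero, zero_smul]

theorem herm_mulVec_eq_zero_of_eigen {A : Sp21} {v x : V} {l : ℍ[ℝ]} (h0 : v ≠ 0)
    (hv : mat A *ᵥ v = v <• l) (hxv : herm x v = 0) : herm (mat A *ᵥ x) v = 0 := by
  have e := herm_mulVec A x v
  rw [hv, herm_smul_right, hxv] at e
  exact (mul_eq_zero.1 e).resolve_left (by simpa using eigenvalue_ne_zero h0 hv)

/-- The polar vector of a hyperbolic pair of eigenvectors is an eigenvector. -/
theorem exists_polar_eigenvector {A : Sp21} {v w : V} {l k : ℍ[ℝ]} (hvv : herm v v = 0)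
    (hww : herm w w = 0) (hvw : herm v w = 1) (hv : mat A *ᵥ v = v <• l)
    (hw : mat A *ᵥ w = w <• k) :
    ∃ (x : V) (m : ℍ[ℝ]), x ≠ 0 ∧ 0 < (herm x x).re ∧ ‖m‖ = 1 ∧ mat A *ᵥ x = x <• m := by
  have hv0 := ne_zero_of_herm_eq_one hvw
  have hw0 : w ≠ 0 := ne_zero_of_herm_eq_one (w := v) (by rw [← star_herm, hvw, star_one])
  obtain ⟨x, hx, hxv, hxw⟩ := exists_orthogonal v w
  obtain ⟨m, hm⟩ := exists_smul_of_orthogonal hvv hww hvw hx hxv hxw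
    (herm_mulVec_eq_zero_of_eigen hv0 hv hxv) (herm_mulVec_eq_zero_of_eigen hw0 hw hxw)
  have hpos := herm_self_pos_of_orthogonal hvv hvw hx hxv hxw
  refine ⟨x, m, hx, hpos, ?_, hm⟩
  have hne : herm x x ≠ 0 := by
    intro h
    simp [h] at hpos
  have := norm_mul_norm_of_herm_ne_zero hm hm hne
  nlinarith [norm_nonneg m]

/-! ### Fixed points of loxodromic elements -/

/-- The eigenvalues at the two fixed boundary points have inverse norms, so only norm one must be
excluded; there a third fixed boundary point or a real eigenvalue appears. -/
theorem IsLoxodromic.exists_attracting_repelling {A : Sp21} (hA : IsLoxodromic A) :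
    (∃ p, IsAttracting A p) ∧ ∃ p, IsRepelling A p := by
  obtain ⟨hyp, hreal⟩ := hA
  obtain ⟨p, q, hpq, hset⟩ := Set.ncard_eq_two.1 hyp
  have hp : p ∈ {p ∈ boundary | A • p = p} := by rw [hset]; simp
  have hq : q ∈ {p ∈ boundary | A • p = p} := by rw [hset]; simp
  obtain ⟨hpb, hpA⟩ := hp
  obtain ⟨hqb, hqA⟩ := hq
  obtain ⟨v, hv, rfl, hvv⟩ := id hpb
  obtain ⟨w₀, hw₀, rfl, hww₀⟩ := id hqb
  obtain ⟨q, hq, hvw⟩ := exists_normalized_of_herm_ne_zero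
    (herm_ne_zero_of_mk_ne hv hw₀ hpq hvv hww₀)
  have hw := smul_right_ne_zero hw₀ hq
  have hmk := (mk_eq_mk_iff_smul_right hw hw₀).2 ⟨q, rfl⟩
  have hww := herm_self_of_mem_boundary hqb hw hmk
  rw [← hmk] at hqA hqb hset
  set w := w₀ <• q
  have hwv : herm w v = 1 := by rw [← star_herm, hvw, star_one]
  obtain ⟨l, hl⟩ := (smul_mk_eq_self_iff hv).1 hpA
  obtain ⟨k, hk⟩ := (smul_mk_eq_self_iff hw).1 hqA
  have hkl := eigenvalue_eq_of_herm_eq_one hl hk hvw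
  have hn := norm_mul_norm_of_herm_ne_zero hl hk (by rw [hvw]; exact one_ne_zero)
  rcases lt_trichotomy ‖l‖ 1 with h | h | h
  · refine ⟨⟨_, hpb, l, h, v, hv, rfl, hl⟩, ⟨_, hqb, k, ?_, w, hw, rfl, hk⟩⟩
    by_contra hc
    nlinarith [norm_nonneg l, norm_nonneg k]
  · exfalso
    have hkl' : k = l := by
      rw [hkl]
      apply inv_eq_of_mul_eq_one_right
      rw [Quaternion.star_mul_self, Quaternion.normSq_eq_norm_mul_self, h]
      simp
    subst hkl'
    -- On normalized lifts both eigenvalues equal `k`. As `z` is purely imaginary and commutes with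
    -- `k`, the vector `v + w <• z` is a null eigenvector. Its line differs from that of `w`, and
    -- equals that of `v` only if `z = 0`, that is, if `k` is real.
    set z := k - star k with hz
    have hsz : star z = -z := by simp [hz]
    have hcomm : k * z = z * k := by
      rw [hz, mul_sub, sub_mul, Quaternion.self_mul_star, Quaternion.star_mul_self]
    have huw : herm (v + w <• z) w = 1 := by
      rw [herm_add_left, herm_smul_left, hvw, hww, zero_mul, add_zero]
    have huv : herm (v + w <• z) v = z := by
      rw [herm_add_left, herm_smul_left, hvv, hwv, one_mul, zero_add]
    have hu := ne_zero_of_herm_eq_one huw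
    have huu : herm (v + w <• z) (v + w <• z) = 0 := by
      rw [herm_add_right, herm_smul_right, huw, huv, hsz, mul_one, add_neg_cancel]
    have hAu : mat A *ᵥ (v + w <• z) = (v + w <• z) <• k := by
      rw [Matrix.mulVec_add, mulVec_smul_right, hl, hk, smul_add,
        smul_right_smul_right w k z, smul_right_smul_right w z k, hcomm]
    have hmem : Projectivization.mk (ℍ[ℝ])ᵐᵒᵖ _ hu ∈ {p ∈ boundary | A • p = p} :=
      ⟨⟨_, hu, rfl, huu⟩, (smul_mk_eq_self_iff hu).2 ⟨k, hAu⟩⟩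
    rw [hset] at hmem
    rcases hmem with hmem | hmem
    · obtain ⟨a, ha⟩ := (mk_eq_mk_iff_smul_right hu hv).1 hmem
      rw [ha, herm_smul_left, hvv, zero_mul] at huv
      have hk' : star k = k := (sub_eq_zero.1 (hz.symm.trans huv.symm)).symm
      exact hreal _ k ⟨v, hv, rfl, hl⟩ k.re (Quaternion.star_eq_self.1 hk')
    · obtain ⟨a, ha⟩ := (mk_eq_mk_iff_smul_right hu hw).1 hmem
      rw [ha, herm_smul_left, hww, zero_mul] at huw
      exact zero_ne_one huw
  · refine ⟨⟨_, hqb, k, ?_, w, hw, rfl, hk⟩, ⟨_, hpb, l, h, v, hv, rfl, hl⟩⟩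
    by_contra hc
    nlinarith [norm_nonneg l, norm_nonneg k]

theorem IsAttracting.exists_lift {A : Sp21} {p : HP2} (h : IsAttracting A p) {v : V} (hv : v ≠ 0)
    (hp : Projectivization.mk (ℍ[ℝ])ᵐᵒᵖ v hv = p) :
    herm v v = 0 ∧ ∃ l : ℍ[ℝ], ‖l‖ < 1 ∧ mat A *ᵥ v = v <• l := by
  obtain ⟨hb, lam, hlam, he⟩ := h
  obtain ⟨l, hl, e⟩ := he.exists_of_mk hv hp
  exact ⟨herm_self_of_mem_boundary hb hv hp, l, hl ▸ hlam, e⟩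

theorem IsRepelling.exists_lift {A : Sp21} {p : HP2} (h : IsRepelling A p) {v : V} (hv : v ≠ 0)
    (hp : Projectivization.mk (ℍ[ℝ])ᵐᵒᵖ v hv = p) :
    herm v v = 0 ∧ ∃ l : ℍ[ℝ], 1 < ‖l‖ ∧ mat A *ᵥ v = v <• l := by
  obtain ⟨hb, lam, hlam, he⟩ := h
  obtain ⟨l, hl, e⟩ := he.exists_of_mk hv hp
  exact ⟨herm_self_of_mem_boundary hb hv hp, l, hl ▸ hlam, e⟩

theorem IsPolar.exists_lift {A : Sp21} {p : HP2} (h : IsPolar A p) {v : V} (hv : v ≠ 0)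
    (hp : Projectivization.mk (ℍ[ℝ])ᵐᵒᵖ v hv = p) :
    0 < (herm v v).re ∧ ∃ l : ℍ[ℝ], ‖l‖ = 1 ∧ mat A *ᵥ v = v <• l := by
  obtain ⟨hb, lam, hlam, he⟩ := h
  obtain ⟨l, hl, e⟩ := he.exists_of_mk hv hp
  exact ⟨herm_self_pos_of_mem_positivePoints hb hv hp, l, hl ▸ hlam, e⟩

theorem IsAttracting.smul_eq {A : Sp21} {p : HP2} (h : IsAttracting A p) : A • p = p :=
  h.2.choose_spec.2.smul_eq

theorem IsRepelling.smul_eq {A : Sp21} {p : HP2} (h : IsRepelling A p) : A • p = p :=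
  h.2.choose_spec.2.smul_eq

/-- Distinct null eigenlines pair nontrivially, so their eigenvalue norms would multiply to one,
though both are below one. -/
theorem IsAttracting.unique {A : Sp21} {p q : HP2} (hp : IsAttracting A p)
    (hq : IsAttracting A q) : p = q := by
  obtain ⟨v, hv, rfl, -⟩ := id hp.1
  obtain ⟨w, hw, rfl, -⟩ := id hq.1
  obtain ⟨hvv, l, hl, e⟩ := hp.exists_lift hv rfl
  obtain ⟨hww, k, hk, e'⟩ := hq.exists_lift hw rfl
  by_contra hne
  have := norm_mul_norm_of_herm_ne_zero e e' (herm_ne_zero_of_mk_ne hv hw hne hvv hww)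
  nlinarith [norm_nonneg l, norm_nonneg k]

theorem IsRepelling.unique {A : Sp21} {p q : HP2} (hp : IsRepelling A p)
    (hq : IsRepelling A q) : p = q := by
  obtain ⟨v, hv, rfl, -⟩ := id hp.1
  obtain ⟨w, hw, rfl, -⟩ := id hq.1
  obtain ⟨hvv, l, hl, e⟩ := hp.exists_lift hv rfl
  obtain ⟨hww, k, hk, e'⟩ := hq.exists_lift hw rfl
  by_contra hne
  have := norm_mul_norm_of_herm_ne_zero e e' (herm_ne_zero_of_mk_ne hv hw hne hvv hww)
  nlinarith [norm_nonneg l, norm_nonneg k]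

theorem IsAttracting.ne_of_isRepelling {A : Sp21} {p q : HP2} (hp : IsAttracting A p)
    (hq : IsRepelling A q) : p ≠ q := by
  rintro rfl
  obtain ⟨v, hv, rfl, -⟩ := id hp.1
  obtain ⟨-, l, hl, e⟩ := hp.exists_lift hv rfl
  obtain ⟨-, k, hk, e'⟩ := hq.exists_lift hv rfl
  have := eq_of_smul_right_eq hv (e.symm.trans e')
  rw [this] at hl
  exact lt_asymm hl hk

/-- Lifts of the attracting and the repelling point, the second one adapted to the first. -/
theorem IsAttracting.exists_hyperbolic_lift {A : Sp21} {p q : HP2} (hp : IsAttracting A p)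
    (hq : IsRepelling A q) {v : V} (hv : v ≠ 0)
    (hpv : Projectivization.mk (ℍ[ℝ])ᵐᵒᵖ v hv = p) :
    ∃ (w : V) (hw : w ≠ 0), Projectivization.mk (ℍ[ℝ])ᵐᵒᵖ w hw = q ∧ herm v v = 0 ∧
      herm w w = 0 ∧ herm v w = 1 := by
  obtain ⟨w, hw, rfl, hww⟩ := id hq.1
  obtain ⟨hvv, -⟩ := hp.exists_lift hv hpv
  subst hpv
  obtain ⟨a, ha, h1⟩ := exists_normalized_of_herm_ne_zero
    (herm_ne_zero_of_mk_ne hv hw (hp.ne_of_isRepelling hq) hvv hww)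
  have hw' := smul_right_ne_zero hw ha
  have hmk := (mk_eq_mk_iff_smul_right hw' hw).2 ⟨a, rfl⟩
  exact ⟨_, hw', hmk, hvv, herm_self_of_mem_boundary hq.1 hw' hmk, h1⟩

theorem IsAttracting.exists_isPolar {A : Sp21} {p q : HP2} (hp : IsAttracting A p)
    (hq : IsRepelling A q) : ∃ s, IsPolar A s := by
  obtain ⟨v, hv, hpv, -⟩ := id hp.1
  obtain ⟨w, hw, hqw, hvv, hww, hvw⟩ := hp.exists_hyperbolic_lift hq hv hpv
  obtain ⟨-, l, -, hl⟩ := hp.exists_lift hv hpv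
  obtain ⟨-, k, -, hk⟩ := hq.exists_lift hw hqw
  obtain ⟨x, m, hx, hpos, hm, e⟩ := exists_polar_eigenvector hvv hww hvw hl hk
  exact ⟨_, ⟨x, hx, rfl, hpos⟩, m, hm, x, hx, rfl, e⟩

theorem IsLoxodromic.fixed_iff {A : Sp21} (hA : IsLoxodromic A) {p q : HP2}
    (hp : IsAttracting A p) (hq : IsRepelling A q) {s : HP2} (hs : s ∈ boundary) :
    A • s = s ↔ s = p ∨ s = q := by
  have hfin : {p ∈ boundary | A • p = p}.Finite :=
    Set.finite_of_ncard_ne_zero (by rw [show _ = 2 from hA.1]; decide)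
  have hsub : ({p, q} : Set HP2) ⊆ {p ∈ boundary | A • p = p} := by
    rintro s (rfl | rfl)
    · exact ⟨hp.1, hp.smul_eq⟩
    · exact ⟨hq.1, hq.smul_eq⟩
  have heq := Set.eq_of_subset_of_ncard_le hsub
    (by rw [Set.ncard_pair (hp.ne_of_isRepelling hq)]; exact hA.1.le) hfin
  constructor
  · intro h
    have : s ∈ {p ∈ boundary | A • p = p} := ⟨hs, h⟩
    rwa [← heq] at this
  · rintro (rfl | rfl)
    · exact hp.smul_eq
    · exact hq.smul_eq

/-! ### Equivariance -/

theorem smul_mem_boundary (g : Sp21) {p : HP2} (h : p ∈ boundary) : g • p ∈ boundary := by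
  obtain ⟨v, hv, rfl, hvv⟩ := h
  exact ⟨mat g *ᵥ v, mulVec_ne_zero g hv, rfl, by rw [herm_mulVec, hvv]⟩

theorem IsEigenpoint.conj (g : Sp21) {A : Sp21} {p : HP2} {lam : ℍ[ℝ]}
    (h : IsEigenpoint A p lam) : IsEigenpoint (g * A * g⁻¹) (g • p) lam := by
  obtain ⟨v, hv, rfl, e⟩ := h
  refine ⟨mat g *ᵥ v, mulVec_ne_zero g hv, rfl, ?_⟩
  rw [← mulVec_smul_right, ← e]
  simp only [mat_mul, Matrix.mulVec_mulVec, mul_assoc, mat_inv_mul, mul_one]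

theorem IsAttracting.conj (g : Sp21) {A : Sp21} {p : HP2} (h : IsAttracting A p) :
    IsAttracting (g * A * g⁻¹) (g • p) :=
  ⟨smul_mem_boundary g h.1, h.2.imp fun _ h => ⟨h.1, h.2.conj g⟩⟩

theorem IsRepelling.conj (g : Sp21) {A : Sp21} {p : HP2} (h : IsRepelling A p) :
    IsRepelling (g * A * g⁻¹) (g • p) :=
  ⟨smul_mem_boundary g h.1, h.2.imp fun _ h => ⟨h.1, h.2.conj g⟩⟩

theorem IsFixedQuadruple.conj (g : Sp21) {A B : Sp21} {q q' : Quadruple}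
    (h : IsFixedQuadruple A B q) (hq : ∀ i, g • q.1 i = q'.1 i) :
    IsFixedQuadruple (g * A * g⁻¹) (g * B * g⁻¹) q' := by
  refine ⟨?_, ?_, ?_, ?_⟩ <;> rw [← hq]
  exacts [h.1.conj g, h.2.1.conj g, h.2.2.1.conj g, h.2.2.2.conj g]

/-! ### The real trace -/

/-- Follows from `j² = -1` and `c j = j (star c)` for complex `c`. -/
theorem complexPart₁_mul (p q : ℍ[ℝ]) : complexPart₁ (p * q) =
    complexPart₁ p * complexPart₁ q - star (complexPart₂ p) * complexPart₂ q := by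
  apply Complex.ext <;> simp [complexPart₁, complexPart₂] <;> ring

theorem complexPart₂_mul (p q : ℍ[ℝ]) : complexPart₂ (p * q) =
    complexPart₂ p * complexPart₁ q + star (complexPart₁ p) * complexPart₂ q := by
  apply Complex.ext <;> simp [complexPart₁, complexPart₂] <;> ring

theorem complexPart₁_add (p q : ℍ[ℝ]) :
    complexPart₁ (p + q) = complexPart₁ p + complexPart₁ q := by
  apply Complex.ext <;> simp [complexPart₁]

theorem complexPart₂_add (p q : ℍ[ℝ]) :
    complexPart₂ (p + q) = complexPart₂ p + complexPart₂ q := by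
  apply Complex.ext <;> simp [complexPart₂] <;> ring

theorem toComplex_mul (A B : Matrix (Fin 3) (Fin 3) ℍ[ℝ]) :
    toComplex (A * B) = toComplex A * toComplex B := by
  rw [toComplex, toComplex, toComplex, Matrix.fromBlocks_multiply]
  congr 1 <;> ext1 i j <;>
    simp [Matrix.mul_apply, Fin.sum_univ_three, complexPart₁_add, complexPart₂_add,
      complexPart₁_mul, complexPart₂_mul] <;> ring

theorem toComplex_diagonal (d : Fin 3 → ℂ) :
    toComplex (Matrix.diagonal fun i => (d i : ℍ[ℝ])) =
      Matrix.fromBlocks (Matrix.diagonal d) 0 0 (Matrix.diagonal fun i => star (d i)) := by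
  rw [toComplex]
  congr 1 <;> ext1 i j <;> by_cases h : i = j <;>
    simp [h, complexPart₁, complexPart₂, Complex.ext_iff]

theorem charpoly_toComplex_conj (g : Sp21) (M : Matrix (Fin 3) (Fin 3) ℍ[ℝ]) :
    (toComplex (mat g * M * mat g⁻¹)).charpoly = (toComplex M).charpoly := by
  rw [toComplex_mul, Matrix.charpoly_mul_comm, ← toComplex_mul, ← mul_assoc, mat_inv_mul, one_mul]

theorem realTrace_conj (g A : Sp21) : realTrace (g * A * g⁻¹) = realTrace A := by
  have : (toComplex (mat (g * A * g⁻¹))).charpoly = (toComplex (mat A)).charpoly :=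
    charpoly_toComplex_conj g (mat A)
  simp only [realTrace, this]

theorem norm_coeComplex (c : ℂ) : ‖(c : ℍ[ℝ])‖ = ‖c‖ := by
  have h : ‖(c : ℍ[ℝ])‖ * ‖(c : ℍ[ℝ])‖ = ‖c‖ * ‖c‖ := by
    rw [← Quaternion.normSq_eq_norm_mul_self, ← sq ‖c‖, ← Complex.normSq_eq_norm_sq]
    simp [Quaternion.normSq_def', Complex.normSq_apply, sq]
  exact (mul_self_inj (norm_nonneg _) (norm_nonneg _)).1 h

theorem coeComplex_star (c : ℂ) : ((star c : ℂ) : ℍ[ℝ]) = star (c : ℍ[ℝ]) := by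
  apply Quaternion.ext <;> simp

theorem coeComplex_inv_star (c : ℂ) : ((star c)⁻¹ : ℂ) = (star (c : ℍ[ℝ]))⁻¹ := by
  by_cases hc : c = 0
  · simp [hc]
  · apply eq_inv_of_mul_eq_one_left
    rw [← coeComplex_star, ← Quaternion.coeComplex_mul,
      inv_mul_cancel₀ (star_ne_zero.2 hc), Quaternion.coeComplex_one]

/-- A matrix is determined by its action on a frame. -/
theorem mul_frame_eq {M : Matrix (Fin 3) (Fin 3) ℍ[ℝ]} {C : Sp21} {v x w : V} {l m k : ℍ[ℝ]}
    (hC : ∀ y : V, mat C *ᵥ y = v <• y 0 + x <• y 1 + w <• y 2) (hv : M *ᵥ v = v <• l)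
    (hx : M *ᵥ x = x <• m) (hw : M *ᵥ w = w <• k) :
    M = mat C * Matrix.diagonal ![l, m, k] * mat C⁻¹ := by
  have h : M * mat C = mat C * Matrix.diagonal ![l, m, k] := by
    apply Matrix.ext_of_mulVec_single
    intro i
    rw [← Matrix.mulVec_mulVec, ← Matrix.mulVec_mulVec, hC, hC]
    simp only [Matrix.mulVec_add, mulVec_smul_right, hv, hx, hw, smul_right_smul_right,
      Matrix.mulVec_diagonal]
    fin_cases i <;> simp
  rw [← h, mul_assoc, mat_mul_inv, mul_one]

theorem charpoly_toComplex_frame (C : Sp21) (l m k : ℂ) :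
    (toComplex (mat C * Matrix.diagonal ![(l : ℍ[ℝ]), (m : ℍ[ℝ]), (k : ℍ[ℝ])] * mat C⁻¹)).charpoly =
      (Polynomial.X - Polynomial.C l) * (Polynomial.X - Polynomial.C m) *
        (Polynomial.X - Polynomial.C k) *
      ((Polynomial.X - Polynomial.C (star l)) * (Polynomial.X - Polynomial.C (star m)) *
        (Polynomial.X - Polynomial.C (star k))) := by
  have hd : Matrix.diagonal ![(l : ℍ[ℝ]), (m : ℍ[ℝ]), (k : ℍ[ℝ])] =
      Matrix.diagonal fun i => ((![l, m, k] i : ℂ) : ℍ[ℝ]) := by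
    congr 1
    ext1 i
    fin_cases i <;> rfl
  rw [charpoly_toComplex_conj, hd, toComplex_diagonal, Matrix.charpoly_fromBlocks_zero₂₁,
    Matrix.charpoly_diagonal, Matrix.charpoly_diagonal, Fin.prod_univ_three, Fin.prod_univ_three]
  rfl

/-- The polynomial with the roots `l, m, (star l)⁻¹` and their conjugates is self-reciprocal with
real coefficients. -/
theorem exists_reciprocal {l m : ℂ} (hl : l ≠ 0) (hm : ‖m‖ = 1) : ∃ a b c : ℝ,
    (Polynomial.X - Polynomial.C l) * (Polynomial.X - Polynomial.C m) *
        (Polynomial.X - Polynomial.C (star l)⁻¹) *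
      ((Polynomial.X - Polynomial.C (star l)) * (Polynomial.X - Polynomial.C (star m)) *
        (Polynomial.X - Polynomial.C (star (star l)⁻¹))) =
    Polynomial.X ^ 6 - Polynomial.C (a : ℂ) * Polynomial.X ^ 5 +
      Polynomial.C (b : ℂ) * Polynomial.X ^ 4 - Polynomial.C (c : ℂ) * Polynomial.X ^ 3 +
      Polynomial.C (b : ℂ) * Polynomial.X ^ 2 - Polynomial.C (a : ℂ) * Polynomial.X + 1 := by
  have hn : Complex.normSq l ≠ 0 := mt Complex.normSq_eq_zero.1 hl
  -- Pairing each root with its conjugate leaves three real quadratics.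
  have quad : ∀ z : ℂ, (Polynomial.X - Polynomial.C z) * (Polynomial.X - Polynomial.C (star z)) =
      Polynomial.X ^ 2 - Polynomial.C ((2 * z.re : ℝ) : ℂ) * Polynomial.X +
        Polynomial.C (Complex.normSq z : ℂ) := by
    intro z
    rw [← Complex.add_conj z, ← Complex.mul_conj z]
    simp only [Polynomial.C_add, Polynomial.C_mul, Complex.star_def]
    ring
  have hinv : (star l)⁻¹.re = l.re * (Complex.normSq l)⁻¹ := by
    simp [Complex.inv_re, div_eq_mul_inv]
  have hm' : Complex.normSq m = 1 := by rw [Complex.normSq_eq_norm_sq, hm]; norm_num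
  set s : ℝ := 2 * l.re
  set t : ℝ := 2 * m.re
  set n : ℝ := Complex.normSq l
  have hNM : Polynomial.C (n : ℂ) * Polynomial.C ((n⁻¹ : ℝ) : ℂ) = 1 := by
    rw [← Polynomial.C_mul, ← Complex.ofReal_mul, mul_inv_cancel₀ hn]
    simp
  -- Coefficients of `(X² - sX + n)(X² - tX + 1)(X² - s n⁻¹ X + n⁻¹)`, simplified with `n * n⁻¹ =
  -- 1`.
  refine ⟨s + s * n⁻¹ + t, n + n⁻¹ + s ^ 2 * n⁻¹ + 1 + t * (s + s * n⁻¹),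
    2 * (s + s * n⁻¹) + t * (n + n⁻¹ + s ^ 2 * n⁻¹), ?_⟩
  have h1 : _ = Polynomial.X ^ 2 - Polynomial.C (s : ℂ) * Polynomial.X + Polynomial.C (n : ℂ) :=
    quad l
  have h2 : _ = Polynomial.X ^ 2 - Polynomial.C (t : ℂ) * Polynomial.X +
    Polynomial.C (Complex.normSq m : ℂ) := quad m
  have h3 := quad (star l)⁻¹
  have e3 : (2 * (star l)⁻¹.re : ℝ) = s * n⁻¹ := by rw [hinv, ← mul_assoc]
  have e3' : Complex.normSq (star l)⁻¹ = n⁻¹ := by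
    rw [map_inv₀]; simp [n]
  rw [e3, e3'] at h3
  rw [hm'] at h2
  rw [mul_mul_mul_comm, mul_mul_mul_comm (Polynomial.X - Polynomial.C l), h1, h2, h3]
  simp only [Complex.ofReal_add, Complex.ofReal_mul, Complex.ofReal_pow, Complex.ofReal_one,
    Complex.ofReal_ofNat, Polynomial.C_add, Polynomial.C_mul, Polynomial.C_pow, Polynomial.C_1,
    map_ofNat] at hNM ⊢
  -- Before `n * n⁻¹ = 1` is used, the product of the two outer quadratics exceeds its palindromic
  -- form by `(n n⁻¹ - 1)(1 - sX)`; the remaining factor is the middle quadratic.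
  linear_combination (1 - Polynomial.C (s : ℂ) * Polynomial.X) *
    (Polynomial.X ^ 2 - Polynomial.C (t : ℂ) * Polynomial.X + 1) * hNM

theorem realTrace_eq_of_charpoly_eq {A : Sp21} {a b c : ℝ}
    (h : (toComplex (mat A)).charpoly =
      Polynomial.X ^ 6 - Polynomial.C (a : ℂ) * Polynomial.X ^ 5 +
      Polynomial.C (b : ℂ) * Polynomial.X ^ 4 - Polynomial.C (c : ℂ) * Polynomial.X ^ 3 +
      Polynomial.C (b : ℂ) * Polynomial.X ^ 2 - Polynomial.C (a : ℂ) * Polynomial.X + 1) :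
    realTrace A = (a, b, c) := by
  rw [realTrace, h]
  simp [Polynomial.coeff_one, Polynomial.coeff_X_pow]

/-- Data of a hyperbolic pair of null eigenvectors with a unit polar eigenvector, for complex
eigenvalue representatives. -/
structure EigenFrame (A : Sp21) (v x w : V) (l m : ℂ) : Prop where
  vv : herm v v = 0
  ww : herm w w = 0
  vw : herm v w = 1
  xv : herm x v = 0
  xw : herm x w = 0
  xx : herm x x = 1
  eigen_v : mat A *ᵥ v = v <• (l : ℍ[ℝ])
  eigen_x : mat A *ᵥ x = x <• (m : ℍ[ℝ])
  eigen_w : ∃ k : ℍ[ℝ], mat A *ᵥ w = w <• k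
  norm_l : ‖l‖ < 1
  norm_m : ‖m‖ = 1
  im_l : 0 ≤ l.im
  im_m : 0 ≤ m.im

theorem EigenFrame.exists_diagonal {A : Sp21} {v x w : V} {l m : ℂ} (h : EigenFrame A v x w l m)
    {C : Sp21} (hC : ∀ y : V, mat C *ᵥ y = v <• y 0 + x <• y 1 + w <• y 2) :
    mat A = mat C * Matrix.diagonal ![(l : ℍ[ℝ]), (m : ℍ[ℝ]), (((star l)⁻¹ : ℂ) : ℍ[ℝ])] *
      mat C⁻¹ := by
  obtain ⟨k, hk⟩ := h.eigen_w
  have := eigenvalue_eq_of_herm_eq_one h.eigen_v hk h.vw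
  rw [← coeComplex_inv_star] at this
  subst this
  exact mul_frame_eq hC h.eigen_v h.eigen_x hk

theorem EigenFrame.l_ne_zero {A : Sp21} {v x w : V} {l m : ℂ} (h : EigenFrame A v x w l m) :
    l ≠ 0 := by
  have := eigenvalue_ne_zero (ne_zero_of_herm_eq_one h.vw) h.eigen_v
  rintro rfl
  simp at this

theorem EigenFrame.charpoly_eq {A : Sp21} {v x w : V} {l m : ℂ} (h : EigenFrame A v x w l m) :
    (toComplex (mat A)).charpoly = (Polynomial.X - Polynomial.C l) *
        (Polynomial.X - Polynomial.C m) * (Polynomial.X - Polynomial.C (star l)⁻¹) *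
      ((Polynomial.X - Polynomial.C (star l)) * (Polynomial.X - Polynomial.C (star m)) *
        (Polynomial.X - Polynomial.C (star (star l)⁻¹))) := by
  obtain ⟨C, hC⟩ := exists_frame h.vv h.ww h.vw h.xv h.xw h.xx
  rw [h.exists_diagonal hC, charpoly_toComplex_frame]

/-- By self-reciprocity and reality, the three coefficients recorded in the real trace fix all the
others. -/
theorem EigenFrame.charpoly_eq_of_realTrace_eq {A A' : Sp21} {v x w v' x' w' : V} {l m l' m' : ℂ}
    (h : EigenFrame A v x w l m) (h' : EigenFrame A' v' x' w' l' m')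
    (ht : realTrace A = realTrace A') :
    (toComplex (mat A)).charpoly = (toComplex (mat A')).charpoly := by
  obtain ⟨a, b, c, e⟩ := exists_reciprocal h.l_ne_zero h.norm_m
  obtain ⟨a', b', c', e'⟩ := exists_reciprocal h'.l_ne_zero h'.norm_m
  rw [← h.charpoly_eq] at e
  rw [← h'.charpoly_eq] at e'
  rw [realTrace_eq_of_charpoly_eq e, realTrace_eq_of_charpoly_eq e'] at ht
  obtain ⟨rfl, rfl, rfl⟩ : a = a' ∧ b = b' ∧ c = c' := by simpa using ht
  rw [e, e']

theorem eq_of_eq_or_eq_star {z w : ℂ} (hz : 0 ≤ z.im) (hw : 0 ≤ w.im) (h : z = w ∨ z = star w) :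
    z = w := by
  rcases h with h | h
  · exact h
  · have him : z.im = -w.im := by rw [h]; simp
    have hre : z.re = w.re := by rw [h]; simp
    exact Complex.ext hre (by linarith)

/-- The three conjugate pairs of roots have norm below, equal to and above one, so the norm of a
root tells which pair it belongs to. -/
theorem EigenFrame.root_cases {A : Sp21} {v x w : V} {l m z : ℂ} (h : EigenFrame A v x w l m)
    (hz : (toComplex (mat A)).charpoly.eval z = 0) :
    (z = l ∨ z = star l) ∨ (z = m ∨ z = star m) ∨ 1 < ‖z‖ := by
  have hinv : 1 < ‖(star l)⁻¹‖ := by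
    rw [norm_inv, norm_star]
    exact (one_lt_inv₀ (norm_pos_iff.2 h.l_ne_zero)).2 h.norm_l
  rw [h.charpoly_eq] at hz
  simp only [Polynomial.eval_mul, Polynomial.eval_sub, Polynomial.eval_X, Polynomial.eval_C,
    mul_eq_zero, sub_eq_zero] at hz
  rcases hz with ((hz | hz) | hz) | ((hz | hz) | hz)
  · exact Or.inl (Or.inl hz)
  · exact Or.inr (Or.inl (Or.inl hz))
  · exact Or.inr (Or.inr (hz ▸ hinv))
  · exact Or.inl (Or.inr hz)
  · exact Or.inr (Or.inl (Or.inr hz))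
  · exact Or.inr (Or.inr (by rw [hz, norm_star]; exact hinv))

/-- The real trace determines the eigenvalue representatives. -/
theorem EigenFrame.eigenvalues_eq {A A' : Sp21} {v x w v' x' w' : V} {l m l' m' : ℂ}
    (h : EigenFrame A v x w l m) (h' : EigenFrame A' v' x' w' l' m')
    (ht : realTrace A = realTrace A') : l' = l ∧ m' = m := by
  have hp := h.charpoly_eq_of_realTrace_eq h' ht
  have hl : (toComplex (mat A)).charpoly.eval l' = 0 := by
    rw [hp, h'.charpoly_eq]; simp
  have hm : (toComplex (mat A)).charpoly.eval m' = 0 := by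
    rw [hp, h'.charpoly_eq]; simp
  have hml := h'.norm_l
  have hmm := h'.norm_m
  constructor
  · rcases h.root_cases hl with e | (e | e) | e
    · exact eq_of_eq_or_eq_star h'.im_l h.im_l e
    · rw [e, h.norm_m] at hml; exact absurd hml (lt_irrefl _)
    · rw [e, norm_star, h.norm_m] at hml; exact absurd hml (lt_irrefl _)
    · exact absurd (hml.trans e) (lt_irrefl _)
  · rcases h.root_cases hm with (e | e) | e | e
    · rw [e] at hmm; exact absurd h.norm_l (by simp [hmm])
    · rw [e, norm_star] at hmm; exact absurd h.norm_l (by simp [hmm])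
    · exact eq_of_eq_or_eq_star h'.im_m h.im_m e
    · rw [hmm] at e; exact absurd e (lt_irrefl _)

theorem EigenFrame.eq {A A' : Sp21} {v x w : V} {l m : ℂ} (h : EigenFrame A v x w l m)
    (h' : EigenFrame A' v x w l m) : A = A' := by
  obtain ⟨C, hC⟩ := exists_frame h.vv h.ww h.vw h.xv h.xw h.xx
  exact mat_injective ((h.exists_diagonal hC).trans (h'.exists_diagonal hC).symm)

/-! ### Projective points -/

theorem exists_projectivePoint (R : Reference) {A : Sp21} {p : HP2} {lam : ℍ[ℝ]}
    (h : IsEigenpoint A p lam) :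
    ∃ (c : ℂ) (P : CP1), ‖c‖ = ‖lam‖ ∧ 0 ≤ c.im ∧ IsProjectivePoint R A p c P := by
  obtain ⟨l, hl, e⟩ := h.exists_of_mk (R.lift_ne_zero p) (R.mk_lift p)
  obtain ⟨q, c, hq, hc, hqc⟩ := exists_complex_similar l
  have hn := norm_eq_of_similar hq hqc
  rw [norm_coeComplex] at hn
  exact ⟨c, ⟦⟨q, hq⟩⟧, hn.trans hl, hc, ⟨q, hq⟩, rfl, mulVec_smul_right_of_eigen e hqc⟩

theorem IsAttracting.exists_firstProjectivePoint (R : Reference) {A : Sp21} {p : HP2}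
    (h : IsAttracting A p) : ∃ P, IsFirstProjectivePoint R A P := by
  obtain ⟨lam, hlam, he⟩ := h.2
  obtain ⟨c, P, hc, hi, hP⟩ := exists_projectivePoint R he
  exact ⟨P, p, c, h, hc ▸ hlam, hi, hP⟩

theorem IsPolar.exists_secondProjectivePoint (R : Reference) {A : Sp21} {p : HP2}
    (h : IsPolar A p) : ∃ P, IsSecondProjectivePoint R A P := by
  obtain ⟨lam, hlam, he⟩ := h.2
  obtain ⟨c, P, hc, hi, hP⟩ := exists_projectivePoint R he
  exact ⟨P, p, c, h, hc ▸ hlam, hi, hP⟩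

theorem herm_eq_zero_of_norm_eq_one {A : Sp21} {x v : V} {m l : ℍ[ℝ]} (hx : mat A *ᵥ x = x <• m)
    (hm : ‖m‖ = 1) (hv : mat A *ᵥ v = v <• l) (hl : ‖l‖ ≠ 1) : herm x v = 0 :=
  herm_eigen_eq_zero hx hv (by rwa [hm, one_mul])

/-- An element is determined by its attracting and repelling points, its real trace and its
projective points. -/
theorem eq_of_projectivePoints (R : Reference) {A A' : Sp21} {a r : HP2} {P Q : CP1}
    (ha : IsAttracting A a) (ha' : IsAttracting A' a) (hr : IsRepelling A r)
    (hr' : IsRepelling A' r) (ht : realTrace A = realTrace A')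
    (hP : IsFirstProjectivePoint R A P) (hP' : IsFirstProjectivePoint R A' P)
    (hQ : IsSecondProjectivePoint R A Q) (hQ' : IsSecondProjectivePoint R A' Q) : A = A' := by
  obtain ⟨p, l, hp, hl, hli, ⟨q, hq⟩, rfl, hv⟩ := hP
  obtain ⟨p', l', hp', hl', hli', ⟨q', hq'⟩, hqq, hv'⟩ := hP'
  obtain rfl := ha.unique hp
  obtain rfl := ha'.unique hp'
  obtain ⟨s, m, hs, hm, hmi, ⟨b, hb⟩, rfl, hx⟩ := hQ
  obtain ⟨s', m', hs', hm', hmi', ⟨b', hb'⟩, hbb, hx'⟩ := hQ'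
  obtain ⟨c, hc, rfl⟩ : ∃ c : ℂ, c ≠ 0 ∧ q' = q * (c : ℍ[ℝ]) := Quotient.exact hqq
  obtain ⟨d, hd, rfl⟩ : ∃ d : ℂ, d ≠ 0 ∧ b' = b * (d : ℍ[ℝ]) := Quotient.exact hbb
  simp only at hv hv' hx hx'
  -- Equal projective points give lifts differing by a complex factor. It commutes with the complex
  -- eigenvalue, so both elements can be compared on the same vector.
  have cancel : ∀ (M : Matrix (Fin 3) (Fin 3) ℍ[ℝ]) (u : V) (e k : ℂ), e ≠ 0 →
      M *ᵥ (u <• (e : ℍ[ℝ])) = (u <• (e : ℍ[ℝ])) <• (k : ℍ[ℝ]) → M *ᵥ u = u <• (k : ℍ[ℝ]) := by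
    intro M u e k he h
    have := mulVec_smul_right_of_eigen (q := ((e⁻¹ : ℂ) : ℍ[ℝ])) (c := (k : ℍ[ℝ])) h
      (by rw [← Quaternion.coeComplex_mul, ← Quaternion.coeComplex_mul, mul_comm])
    rwa [smul_right_smul_right, ← Quaternion.coeComplex_mul, mul_inv_cancel₀ he,
      Quaternion.coeComplex_one, op_one, one_smul] at this
  rw [← smul_right_smul_right] at hv' hx'
  have hv' := cancel _ _ _ _ hc hv'
  have hx' := cancel _ _ _ _ hd hx'
  set v := R.lift a <• q with hvdef
  have hv0 : v ≠ 0 := smul_right_ne_zero (R.lift_ne_zero a) hq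
  have hva : Projectivization.mk (ℍ[ℝ])ᵐᵒᵖ v hv0 = a := by
    conv_rhs => rw [← R.mk_lift a]
    exact (mk_eq_mk_iff_smul_right _ _).2 ⟨q, rfl⟩
  obtain ⟨w, hw0, hwr, hvv, hww, hvw⟩ := ha.exists_hyperbolic_lift hr hv0 hva
  obtain ⟨-, k, hk, hw⟩ := hr.exists_lift hw0 hwr
  obtain ⟨-, k', hk', hw'⟩ := hr'.exists_lift hw0 hwr
  have nl : ‖(l : ℍ[ℝ])‖ ≠ 1 := by rw [norm_coeComplex]; exact hl.ne
  have nl' : ‖(l' : ℍ[ℝ])‖ ≠ 1 := by rw [norm_coeComplex]; exact hl'.ne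
  have nm : ‖(m : ℍ[ℝ])‖ = 1 := by rw [norm_coeComplex]; exact hm
  have nm' : ‖(m' : ℍ[ℝ])‖ = 1 := by rw [norm_coeComplex]; exact hm'
  have hx0 : R.lift s <• b ≠ 0 := smul_right_ne_zero (R.lift_ne_zero s) hb
  have hx0' : R.lift s' <• b ≠ 0 := smul_right_ne_zero (R.lift_ne_zero s') hb
  have xv := herm_eq_zero_of_norm_eq_one hx nm hv nl
  have xw := herm_eq_zero_of_norm_eq_one hx nm hw hk.ne'
  have xv' := herm_eq_zero_of_norm_eq_one hx' nm' hv' nl'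
  have xw' := herm_eq_zero_of_norm_eq_one hx' nm' hw' hk'.ne'
  -- Both polar points are the orthogonal complement of the common vectors `v` and `w`.
  have hss : s = s' := by
    have h1 : herm (R.lift s) v = 0 := by
      rw [herm_smul_left] at xv; exact (mul_eq_zero.1 xv).resolve_right hb
    have h2 : herm (R.lift s) w = 0 := by
      rw [herm_smul_left] at xw; exact (mul_eq_zero.1 xw).resolve_right hb
    have h1' : herm (R.lift s') v = 0 := by
      rw [herm_smul_left] at xv'; exact (mul_eq_zero.1 xv').resolve_right hb
    have h2' : herm (R.lift s') w = 0 := by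
      rw [herm_smul_left] at xw'; exact (mul_eq_zero.1 xw').resolve_right hb
    rw [← R.mk_lift s, ← R.mk_lift s']
    exact (mk_eq_mk_iff_smul_right _ _).2
      (exists_smul_of_orthogonal hvv hww hvw (R.lift_ne_zero s') h1' h2' h1 h2)
  subst hss
  -- Rescaling by a real, hence central, factor leaves the eigenvalues on the polar vector
  -- unchanged.
  obtain ⟨t, ht0, hxx⟩ := exists_unit_of_pos (herm_self_pos_of_orthogonal hvv hvw hx0 xv xw)
  have F : EigenFrame A v ((R.lift s <• b) <• (t : ℍ[ℝ])) w l m :=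
    { vv := hvv, ww := hww, vw := hvw, xx := hxx, eigen_v := hv, eigen_w := ⟨k, hw⟩
      xv := by rw [herm_smul_left, xv, zero_mul]
      xw := by rw [herm_smul_left, xw, zero_mul]
      eigen_x := mulVec_smul_right_of_eigen hx (Quaternion.coe_commutes t _).symm
      norm_l := hl, norm_m := hm, im_l := hli, im_m := hmi }
  have FF : EigenFrame A' v ((R.lift s <• b) <• (t : ℍ[ℝ])) w l' m' :=
    { vv := hvv, ww := hww, vw := hvw, xx := hxx, eigen_v := hv', eigen_w := ⟨k', hw'⟩
      xv := by rw [herm_smul_left, xv, zero_mul]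
      xw := by rw [herm_smul_left, xw, zero_mul]
      eigen_x := mulVec_smul_right_of_eigen hx' (Quaternion.coe_commutes t _).symm
      norm_l := hl', norm_m := hm', im_l := hli', im_m := hmi' }
  obtain ⟨rfl, rfl⟩ := F.eigenvalues_eq FF ht
  exact F.eq FF

/-! ### Parameters of a pair -/

theorem exists_hasParameters (R : Reference) {A B : Sp21} (h : TotallyLoxodromic A B) :
    ∃ w : Parameters, HasParameters R A B w := by
  obtain ⟨⟨a, ha⟩, ⟨r, hr⟩⟩ := h.1.exists_attracting_repelling
  obtain ⟨⟨a', ha'⟩, ⟨r', hr'⟩⟩ := h.2.exists_attracting_repelling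
  let q : Quadruple := ⟨![a, r, a', r'], fun i => by
    fin_cases i
    exacts [ha.1, hr.1, ha'.1, hr'.1]⟩
  have hq : IsFixedQuadruple A B q := ⟨ha, hr, ha', hr'⟩
  obtain ⟨g, hg⟩ : ∃ g : Sp21, ∀ i, g • q.1 i = (R.quad ⟦q⟧).1 i :=
    Quotient.exact (R.quad_class ⟦q⟧).symm
  have hg' := hq.conj g hg
  obtain ⟨s, hs⟩ := hg'.1.exists_isPolar hg'.2.1
  obtain ⟨s', hs'⟩ := hg'.2.2.1.exists_isPolar hg'.2.2.2
  obtain ⟨P, hP⟩ := hg'.1.exists_firstProjectivePoint R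
  obtain ⟨Q, hQ⟩ := hs.exists_secondProjectivePoint R
  obtain ⟨P', hP'⟩ := hg'.2.2.1.exists_firstProjectivePoint R
  obtain ⟨Q', hQ'⟩ := hs'.exists_secondProjectivePoint R
  exact ⟨⟨realTrace A, realTrace B, ⟦q⟧, P, Q, P', Q'⟩, rfl, rfl, ⟨q, hq, rfl⟩, g, hg', hP, hQ,
    hP', hQ'⟩

theorem HasParameters.conj {R : Reference} {A B : Sp21} {w : Parameters}
    (h : HasParameters R A B w) (g : Sp21) :
    HasParameters R (g * A * g⁻¹) (g * B * g⁻¹) w := by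
  obtain ⟨hA, hB, ⟨q, hq, hqw⟩, k, hk⟩ := h
  refine ⟨(realTrace_conj g A).trans hA, (realTrace_conj g B).trans hB,
    ⟨⟨fun i => g • q.1 i, fun i => smul_mem_boundary g (q.2 i)⟩, hq.conj g fun i => rfl, ?_⟩,
    -- Undoing `g` before applying `k` reaches the same normalized pair, so all projective points
    -- persist.
    k * g⁻¹, ?_⟩
  · rw [← hqw]
    exact Quotient.sound (Setoid.symm ⟨g, fun i => rfl⟩)
  · have e : ∀ X : Sp21, k * g⁻¹ * (g * X * g⁻¹) * (k * g⁻¹)⁻¹ = k * X * k⁻¹ := fun X => by group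
    rw [e, e]
    exact hk

theorem ConjugatePairs.symm {A B A' B' : Sp21} (h : ConjugatePairs A B A' B') :
    ConjugatePairs A' B' A B := by
  obtain ⟨g, rfl, rfl⟩ := h
  exact ⟨g⁻¹, by group, by group⟩

theorem ConjugatePairs.hasParameters {R : Reference} {A B A' B' : Sp21} {w : Parameters}
    (h : ConjugatePairs A B A' B') (hw : HasParameters R A B w) : HasParameters R A' B' w := by
  obtain ⟨g, rfl, rfl⟩ := h
  exact hw.conj g

/-- The normalized pairs share fixed points, traces and projective points, hence coincide; composing
one normalization with the inverse of the other conjugates the original pairs. -/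
theorem HasParameters.conjugatePairs {R : Reference} {A B A' B' : Sp21} {w : Parameters}
    (h : HasParameters R A B w) (h' : HasParameters R A' B' w) : ConjugatePairs A B A' B' := by
  obtain ⟨hA, hB, -, g, hg, hP, hQ, hP₂, hQ₂⟩ := h
  obtain ⟨hA', hB', -, g', hg', hP', hQ', hP₂', hQ₂'⟩ := h'
  have eA : g * A * g⁻¹ = g' * A' * g'⁻¹ := eq_of_projectivePoints R hg.1 hg'.1 hg.2.1 hg'.2.1
    (by rw [realTrace_conj, realTrace_conj, hA, hA']) hP hP' hQ hQ'
  have eB : g * B * g⁻¹ = g' * B' * g'⁻¹ := eq_of_projectivePoints R hg.2.2.1 hg'.2.2.1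
    hg.2.2.2 hg'.2.2.2 (by rw [realTrace_conj, realTrace_conj, hB, hB']) hP₂ hP₂' hQ₂ hQ₂'
  refine ⟨g'⁻¹ * g, ?_, ?_⟩
  · calc g'⁻¹ * g * A * (g'⁻¹ * g)⁻¹ = g'⁻¹ * (g * A * g⁻¹) * g' := by group
      _ = A' := by rw [eA]; group
  · calc g'⁻¹ * g * B * (g'⁻¹ * g)⁻¹ = g'⁻¹ * (g * B * g⁻¹) * g' := by group
      _ = B' := by rw [eB]; group

theorem mk_mem_M2_iff (q : Quadruple) : (⟦q⟧ : Configuration) ∈ M2 ↔ Function.Injective q.1 := by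
  constructor
  · rintro ⟨q', hinj, h⟩
    obtain ⟨g, hg⟩ : ∃ g : Sp21, ∀ i, g • q'.1 i = q.1 i := Quotient.exact h
    intro i j hij
    rw [← hg, ← hg] at hij
    exact hinj (smul_left_cancel g hij)
  · exact fun h => ⟨q, h, rfl⟩

/-- Within one element the attracting and repelling points never coincide, so any coincidence in `q`
is a common fixed point. Conversely, a common fixed boundary point occurs among the first two
entries and among the last two. -/
theorem IsFixedQuadruple.injective_iff {A B : Sp21} (hAB : TotallyLoxodromic A B) {q : Quadruple}
    (hq : IsFixedQuadruple A B q) :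
    Function.Injective q.1 ↔ ∀ p ∈ boundary, ¬ (A • p = p ∧ B • p = p) := by
  obtain ⟨ha, hr, ha', hr'⟩ := hq
  constructor
  · rintro hinj p hp ⟨h, h'⟩
    rw [hAB.1.fixed_iff ha hr hp] at h
    rw [hAB.2.fixed_iff ha' hr' hp] at h'
    rcases h with rfl | rfl <;> rcases h' with h' | h' <;> exact absurd (hinj h') (by decide)
  · intro h i j hij
    have h01 := ha.ne_of_isRepelling hr
    have h23 := ha'.ne_of_isRepelling hr'
    have cross : ∀ s t, A • s = s → B • t = t → s ∈ boundary → s ≠ t := by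
      rintro s _ hs ht hb rfl
      exact h s hb ⟨hs, ht⟩
    have h02 := cross _ _ ha.smul_eq ha'.smul_eq ha.1
    have h03 := cross _ _ ha.smul_eq hr'.smul_eq ha.1
    have h12 := cross _ _ hr.smul_eq ha'.smul_eq hr.1
    have h13 := cross _ _ hr.smul_eq hr'.smul_eq hr.1
    fin_cases i <;> fin_cases j <;> first
      | rfl
      | exact absurd hij ‹_›
      | exact absurd hij.symm ‹_›

end QuatHyp
end

theorem theorem1p2 (R : Reference) (A B : Sp21) (hAB : TotallyLoxodromic A B) :
    (∃ w : Parameters, HasParameters R A B w) ∧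
    (∀ w : Parameters, HasParameters R A B w →
      (w.config ∈ M2 ↔ ∀ p ∈ boundary, ¬ (A • p = p ∧ B • p = p))) ∧
    ∀ A' B' : Sp21, TotallyLoxodromic A' B' →
      (ConjugatePairs A B A' B' ↔
        ∃ w : Parameters, HasParameters R A B w ∧ HasParameters R A' B' w) ∧
      (ConjugatePairs A B A' B' ↔
        ∀ w : Parameters, HasParameters R A B w ↔ HasParameters R A' B' w) := by
  -- Without some `w₀`, equality of the sets of parameters could hold vacuously; with it, equal sets
  -- yield a common value.
  obtain ⟨w₀, hw₀⟩ := exists_hasParameters R hAB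
  refine ⟨⟨w₀, hw₀⟩, ?_, fun A' B' _ => ⟨⟨fun h => ⟨w₀, hw₀, h.hasParameters hw₀⟩, ?_⟩,
    ⟨fun h w => ⟨h.hasParameters, h.symm.hasParameters⟩, fun h =>
      hw₀.conjugatePairs ((h w₀).1 hw₀)⟩⟩⟩
  · rintro w ⟨-, -, ⟨q, hq, hqw⟩, -⟩
    rw [← hqw, mk_mem_M2_iff, hq.injective_iff hAB]
  · rintro ⟨w, hw, hw'⟩
    exact hw.conjugatePairs hw'
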